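/- For a graph $G$ on $[n]=\{1,\dots,n\}$, an integer $k\ge 3$ and an edge $uv\in E(G)$, let $c_k(u,v;G)$ denote the number of $k$-cycles in $G$ that contain the edge $uv$. For an integer $m\ge 3$ and a real number $L>0$, let $\mathcal{G}_n(m,L)$ be the family of graphs $G$ on the vertex set $[n]$ such that $c_k(u,v;G)\le L$ for every $3\le k\le m$ and every $uv\in E(G)$. Theorem. Let $\ell\ge 3$ be an integer and let $L>0$ be a constant. Then there is an integer $N$, depending only on $\ell$ and $L$, such that for every integer $n\ge N$, $$|\mathcal{G}_n(2\ell,L)|\le 2^{3(\ell+1)n^{1+1/\ell}}.$$ -/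

import Mathlib

/-- The number of `k`-cycles of `G` that contain the edge `uv`. A cycle is identified with its
set of edges, so the starting point and the direction of traversal do not matter. -/
noncomputable def cycleCount {V : Type*} (G : SimpleGraph V) (k : ℕ) (u v : V) : ℕ :=
  {C : Set (Sym2 V) | ∃ (w : V) (p : G.Walk w w),
    p.IsCycle ∧ p.length = k ∧ C = {e | e ∈ p.edges} ∧ s(u, v) ∈ C}.ncard

/-- The family `𝒢_n(m, L)` of graphs on an `n`-element labelled vertex set in which every edge
lies in at most `L` cycles of length `k`, for every `3 ≤ k ≤ m`. -/
def sparseCycleFamily (n m : ℕ) (L : ℝ) : Set (SimpleGraph (Fin n)) :=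
  {G | ∀ k : ℕ, 3 ≤ k → k ≤ m → ∀ u v : Fin n, G.Adj u v → (cycleCount G k u v : ℝ) ≤ L}

/-! The argument is of Kleitman–Winston type. Write `x = n^(1/ℓ)`. Deleting a vertex `v` of minimum
degree `d` leaves a graph whose other vertices have degree at least `d - 1`, and the original graph
is recovered from `v`, its neighbourhood and the remaining graph. It therefore suffices to allow
about `2^(3ℓx)` neighbourhoods per deletion, up to a factor whose exponent is polylogarithmic in `n`
(`card_fewReturnsOn_le`).

Two neighbours of `v` joined by a walk of length at most `2ℓ - 2` avoiding `v` lie with `v` on a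
cycle of length at most `2ℓ`, so each neighbour is close to boundedly many others. In the remaining
graph, however, the vertices reached by branches of length `ℓ - 1` number about `d^(ℓ-1)` from each
root, while two roots share only `O(d^(ℓ-2))` of them (`pow_le_card_layer`, `card_layer_inter_le`).
By Cauchy–Schwarz, a set of more than `(2x)^ℓ / d^(ℓ-1)` vertices has a member close to at least a
`1 / polylog n` proportion of it (`FewReturns.exists_dense_vertex`). Hence, outside a
polylogarithmic part, a neighbourhood lies in a container of at most that size fixed by a short
fingerprint (`exists_containers`), and such a container has at most `e^(2ℓx) ≤ 2^(3ℓx)` subsets of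
size at most `d`. For `d` below `x / log₂(n+1)` the trivial count is enough. -/

section
open scoped Classical
open Finset SimpleGraph

variable {V : Type*} [Fintype V]

/-! ### Short returns and cycles -/

/-- The neighbours `x ≠ z` of `y` that can be reached from `z` by a walk of length at most `m`
avoiding `y`. -/
noncomputable def shortReturn (G : SimpleGraph V) (m : ℕ) (y z : V) : Finset V :=
  univ.filter fun x => G.Adj y x ∧ x ≠ z ∧ ∃ w : G.Walk z x, w.length ≤ m ∧ y ∉ w.support

theorem mem_shortReturn {G : SimpleGraph V} {m : ℕ} {x y z : V} :
    x ∈ shortReturn G m y z ↔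
      G.Adj y x ∧ x ≠ z ∧ ∃ w : G.Walk z x, w.length ≤ m ∧ y ∉ w.support := by
  simp [shortReturn]

theorem exists_cycle_of_mem_shortReturn {G : SimpleGraph V} {m : ℕ} {x y z : V}
    (hyz : G.Adj y z) (hx : x ∈ shortReturn G m y z) :
    ∃ p : G.Walk y y, p.IsCycle ∧ 3 ≤ p.length ∧ p.length ≤ m + 2 ∧ s(y, z) ∈ p.edges ∧
      s(y, x) ∈ p.edges ∧ ∀ x', s(y, x') ∈ p.edges → x' = z ∨ x' = x := by
  obtain ⟨hyx, hxz, w, hw, hy⟩ := mem_shortReturn.1 hx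
  have hyp : y ∉ w.bypass.support := fun h => hy (w.support_bypass_subset_support h)
  have hne : w.bypass.length ≠ 0 := fun h => hxz (Walk.eq_of_length_eq_zero h).symm
  have hedge : ∀ x', s(y, x') ∈ (Walk.cons hyz (w.bypass.concat hyx.symm)).edges →
      x' = z ∨ x' = x := by
    intro x' h
    rw [Walk.edges_cons, Walk.edges_concat, List.mem_cons, List.concat_eq_append,
      List.mem_append, List.mem_singleton] at h
    rcases h with h | h | h
    · exact Or.inl (Sym2.congr_right.1 h)
    · exact absurd (Walk.fst_mem_support_of_mem_edges _ h) hyp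
    · rw [Sym2.eq_swap (a := x)] at h
      exact Or.inr (Sym2.congr_right.1 h)
  refine ⟨Walk.cons hyz (w.bypass.concat hyx.symm), ?_, ?_, ?_, ?_, ?_, hedge⟩
  · rw [Walk.cons_isCycle_iff, Walk.concat_isPath_iff]
    refine ⟨⟨w.bypass_isPath, hyp⟩, fun h => ?_⟩
    rw [Walk.edges_concat, List.concat_eq_append, List.mem_append, List.mem_singleton] at h
    rcases h with h | h
    · exact hyp (Walk.fst_mem_support_of_mem_edges _ h)
    · rw [Sym2.eq_swap (a := x)] at h
      exact hxz (Sym2.congr_right.1 h).symm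
  · simp only [Walk.length_cons, Walk.length_concat]
    omega
  · simp only [Walk.length_cons, Walk.length_concat]
    have := w.length_bypass_le_length
    omega
  · simp
  · simp [Walk.edges_concat, Sym2.eq_swap (a := x)]

/-- A short return `x` closes a cycle through `yz`, and the cycle remembers `x` as the neighbour of
`y` on it other than `z`, so distinct returns give distinct edge sets. -/
theorem card_shortReturn_le {G : SimpleGraph V} {m : ℕ} {y z : V} (hyz : G.Adj y z) :
    #(shortReturn G m y z) ≤ ∑ k ∈ Icc 3 (m + 2), cycleCount G k y z := by
  have h : ∀ x : V, ∃ p : G.Walk y y, x ∈ shortReturn G m y z →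
      p.IsCycle ∧ 3 ≤ p.length ∧ p.length ≤ m + 2 ∧ s(y, z) ∈ p.edges ∧
      s(y, x) ∈ p.edges ∧ ∀ x', s(y, x') ∈ p.edges → x' = z ∨ x' = x := by
    intro x
    by_cases hx : x ∈ shortReturn G m y z
    · obtain ⟨p, hp⟩ := exists_cycle_of_mem_shortReturn hyz hx
      exact ⟨p, fun _ => hp⟩
    · exact ⟨Walk.nil, fun h => absurd h hx⟩
  choose p hp using h
  rw [← Set.ncard_coe_finset]
  refine le_trans (Set.ncard_le_ncard_of_injOn
    (t := ⋃ k ∈ Icc 3 (m + 2), {C : Set (Sym2 V) | ∃ (w : V) (p : G.Walk w w),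
      p.IsCycle ∧ p.length = k ∧ C = {e | e ∈ p.edges} ∧ s(y, z) ∈ C})
    (fun x => {e | e ∈ (p x).edges}) ?_ ?_ (Set.toFinite _))
    (Finset.set_ncard_biUnion_le _ _)
  · intro x hx
    obtain ⟨h1, h2, h3, h4, -⟩ := hp x hx
    simp only [Set.mem_iUnion]
    exact ⟨(p x).length, mem_Icc.2 ⟨h2, h3⟩, y, p x, h1, rfl, rfl, h4⟩
  · intro x hx x' hx' hxx'
    have h1 : s(y, x) ∈ {e | e ∈ (p x').edges} := by
      rw [← show {e | e ∈ (p x).edges} = {e | e ∈ (p x').edges} from hxx']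
      exact (hp x hx).2.2.2.2.1
    exact ((hp x' hx').2.2.2.2.2 x h1).resolve_left (mem_shortReturn.1 hx).2.1

/-- Every edge `yz` has at most `K` short returns at `y`, in the sense of `shortReturn`. -/
def FewReturns (G : SimpleGraph V) (m K : ℕ) : Prop :=
  ∀ y z, G.Adj y z → #(shortReturn G m y z) ≤ K

theorem FewReturns.mono {G G' : SimpleGraph V} {m K : ℕ} (h : FewReturns G m K) (hle : G' ≤ G) :
    FewReturns G' m K := by
  intro y z hyz
  refine (card_le_card fun x hx => ?_).trans (h y z (hle hyz))
  obtain ⟨h1, h2, w, h3, h4⟩ := mem_shortReturn.1 hx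
  exact mem_shortReturn.2 ⟨hle h1, h2, w.mapLe hle, by simpa using h3, by simpa using h4⟩

end

/-- Closing a walk at `y` adds two edges, hence the length `2ℓ - 2`. Fewer than `2ℓ` cycle lengths
occur. -/
theorem fewReturns_of_mem_sparseCycleFamily {n ℓ : ℕ} {L : ℝ} (hℓ : 1 ≤ ℓ)
    {G : SimpleGraph (Fin n)} (hG : G ∈ sparseCycleFamily n (2 * ℓ) L) :
    FewReturns G (2 * ℓ - 2) (2 * ℓ * ⌊L⌋₊) := by
  intro y z hyz
  refine (card_shortReturn_le hyz).trans ?_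
  have h : ∀ k ∈ Finset.Icc 3 (2 * ℓ - 2 + 2), cycleCount G k y z ≤ ⌊L⌋₊ := by
    intro k hk
    rw [Finset.mem_Icc] at hk
    exact Nat.le_floor (hG k hk.1 (by omega) y z hyz)
  refine (Finset.sum_le_card_nsmul _ _ _ h).trans ?_
  rw [smul_eq_mul, Nat.card_Icc]
  exact Nat.mul_le_mul_right _ (by omega)

/-! ### Branches and their layers -/

section
open scoped Classical
open Finset SimpleGraph

theorem length_of_support_eq_cons {V : Type*} {G : SimpleGraph V} {x y : V} {w : G.Walk x y} {t : List V}
    (h : w.support = x :: t) : w.length = t.length := by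
  have := w.length_support
  rw [h, List.length_cons] at this
  omega

variable {V : Type*} [Fintype V]

/-- A branch from `a`, listed from its tip back to `a`: each step goes from a vertex to one of its
selected successors `S`, and neither turns back nor closes a short cycle with the previous step. -/
def IsBranch (G : SimpleGraph V) (m : ℕ) (S : V → Finset V) (a : V) : List V → Prop
  | [] => False
  | [x] => x = a
  | [x, y] => y = a ∧ x ∈ S y
  | x :: y :: z :: t => x ∈ S y ∧ x ≠ z ∧ x ∉ shortReturn G m y z ∧
      IsBranch G m S a (y :: z :: t)

variable {G : SimpleGraph V} {m : ℕ} {S : V → Finset V} {a : V}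

theorem IsBranch.tail {x y : V} {t : List V} (h : IsBranch G m S a (x :: y :: t)) :
    x ∈ S y ∧ IsBranch G m S a (y :: t) := by
  cases t with
  | nil => exact ⟨h.2, h.1⟩
  | cons z t => exact ⟨h.1, h.2.2.2⟩

theorem IsBranch.of_append {s : List V} {y : V} {t : List V}
    (h : IsBranch G m S a (s ++ y :: t)) : IsBranch G m S a (y :: t) := by
  induction s with
  | nil => exact h
  | cons x s ih =>
    apply ih
    cases s with
    | nil => exact h.tail.2
    | cons z s => exact h.tail.2

theorem IsBranch.exists_walk (hS : ∀ u, ∀ v ∈ S u, G.Adj u v) {x : V} {t : List V}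
    (h : IsBranch G m S a (x :: t)) : ∃ w : G.Walk x a, w.support = x :: t := by
  induction t generalizing x with
  | nil =>
    obtain rfl : x = a := h
    exact ⟨Walk.nil, rfl⟩
  | cons y t ih =>
    obtain ⟨w, hw⟩ := ih h.tail.2
    exact ⟨Walk.cons (hS _ _ h.tail.1).symm w, by simp [hw]⟩

/-- Let `y` precede `x` on the longer branch. If the other branch passes through `y`, induction at
`y` identifies the two. Otherwise, going from the predecessor `z` of `y` down to the root and back
up the other branch to `x` avoids `y`, making `x` a forbidden short return. Unequal lengths are
allowed so that the induction also excludes repeated vertices. -/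
theorem IsBranch.unique (hS : ∀ u, ∀ v ∈ S u, G.Adj u v) {x : V} {p q : List V}
    (hp : IsBranch G m S a (x :: p)) (hq : IsBranch G m S a (x :: q))
    (hqp : q.length ≤ p.length) (hm : 2 * p.length ≤ m) : p = q := by
  induction p generalizing x q with
  | nil => simpa using (List.length_eq_zero_iff.1 (Nat.le_zero.1 hqp)).symm
  | cons y p ih =>
    rw [List.length_cons] at hqp hm
    have hxy : G.Adj y x := hS _ _ hp.tail.1
    by_cases hyq : y ∈ q
    · obtain ⟨s, t, rfl⟩ := List.append_of_mem hyq
      have ht : IsBranch G m S a (y :: t) := IsBranch.of_append (s := x :: s) hq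
      simp only [List.length_append, List.length_cons] at hqp
      have hpt := ih hp.tail.2 ht (by omega) (by omega)
      have hs : s = [] := by
        rw [← List.length_eq_zero_iff, ← Nat.le_zero]
        rw [hpt] at hqp
        omega
      simp [hs, hpt]
    exfalso
    have hyp : y ∉ p := by
      intro hyp
      obtain ⟨s, t, rfl⟩ := List.append_of_mem hyp
      have ht : IsBranch G m S a (y :: t) := IsBranch.of_append (s := x :: y :: s) hp
      have := congrArg List.length (ih hp.tail.2 ht (by simp; omega) (by omega))
      simp at this
      omega
    obtain ⟨w, hw⟩ := hq.exists_walk hS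
    cases p with
    | nil =>
      have hya : y = a := hp.tail.2
      have : a ∈ w.support := w.end_mem_support
      rw [hw, ← hya, List.mem_cons] at this
      exact this.elim hxy.ne hyq
    | cons z p =>
      obtain ⟨w', hw'⟩ := hp.tail.2.tail.2.exists_walk hS
      refine hp.2.2.1 (mem_shortReturn.2 ⟨hxy, hp.2.1, w'.append w.reverse, ?_, ?_⟩)
      · rw [Walk.length_append, Walk.length_reverse, length_of_support_eq_cons hw,
          length_of_support_eq_cons hw']
        rw [List.length_cons] at hqp hm
        omega
      · rw [Walk.mem_support_append_iff, Walk.support_reverse, List.mem_reverse, hw, hw']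
        rintro (h | h)
        · exact hyp h
        · rcases List.mem_cons.1 h with h | h
          · exact hxy.ne h
          · exact hyq h

/-- The tips of the branches of length `j` from `a`. -/
noncomputable def layer (G : SimpleGraph V) (m : ℕ) (S : V → Finset V) (a : V) (j : ℕ) :
    Finset V :=
  univ.filter fun x => ∃ p, IsBranch G m S a (x :: p) ∧ p.length = j

theorem mem_layer {j : ℕ} {x : V} :
    x ∈ layer G m S a j ↔ ∃ p, IsBranch G m S a (x :: p) ∧ p.length = j := by
  simp [layer]

theorem layer_zero : layer G m S a 0 = {a} := by
  ext x
  simp only [mem_layer, mem_singleton, List.length_eq_zero_iff]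
  constructor
  · rintro ⟨p, h, rfl⟩
    exact h
  · intro h
    exact ⟨[], h, rfl⟩

theorem layer_succ_subset (j : ℕ) :
    layer G m S a (j + 1) ⊆ (layer G m S a j).biUnion S := by
  intro x hx
  obtain ⟨p, hp, hj⟩ := mem_layer.1 hx
  obtain ⟨y, p, rfl⟩ := List.exists_cons_of_length_eq_add_one hj
  exact mem_biUnion.2 ⟨y, mem_layer.2 ⟨p, hp.tail.2, by simpa using hj⟩, hp.tail.1⟩

theorem card_layer_le {D : ℕ} (hD : ∀ u, #(S u) ≤ D) (j : ℕ) :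
    #(layer G m S a j) ≤ D ^ j := by
  induction j with
  | zero => simp [layer_zero]
  | succ j ih =>
    refine (card_le_card (layer_succ_subset j)).trans ?_
    refine (card_biUnion_le_card_mul _ _ D fun u _ => hD u).trans ?_
    rw [pow_succ]
    exact Nat.mul_le_mul_right _ ih

theorem layer_subset {U : Finset V} (ha : a ∈ U) (hU : ∀ u, S u ⊆ U) (j : ℕ) :
    layer G m S a j ⊆ U := by
  cases j with
  | zero => simpa [layer_zero] using ha
  | succ j =>
    refine (layer_succ_subset j).trans ?_
    exact biUnion_subset.2 fun u _ => hU u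

/-- All but `K + 1` successors of `y` extend its branch: the exceptions are the predecessor of `y`
and the short returns. By uniqueness of branches, different `y` have disjoint sets of extensions. -/
theorem card_layer_succ_ge (hS : ∀ u, ∀ v ∈ S u, G.Adj u v) {K D j : ℕ} (hG : FewReturns G m K)
    {U : Finset V} (ha : a ∈ U) (hU : ∀ u, S u ⊆ U) (hD : ∀ u ∈ U, D ≤ #(S u))
    (hj : 2 * (j + 1) ≤ m) :
    #(layer G m S a j) * (D - (K + 1)) ≤ #(layer G m S a (j + 1)) := by
  have h : ∀ y, ∃ p : List V, y ∈ layer G m S a j →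
      IsBranch G m S a (y :: p) ∧ p.length = j := by
    intro y
    by_cases hy : y ∈ layer G m S a j
    · obtain ⟨p, hp⟩ := mem_layer.1 hy
      exact ⟨p, fun _ => hp⟩
    · exact ⟨[], fun h => absurd h hy⟩
  choose p hp using h
  have hsub : (layer G m S a j).biUnion
      (fun y => (S y).filter fun x => IsBranch G m S a (x :: y :: p y)) ⊆
        layer G m S a (j + 1) := by
    refine biUnion_subset.2 fun y hy x hx => ?_
    exact mem_layer.2 ⟨y :: p y, (mem_filter.1 hx).2, by simp [(hp y hy).2]⟩
  refine le_trans ?_ (card_le_card hsub)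
  rw [card_biUnion]
  · rw [← smul_eq_mul]
    refine card_nsmul_le_sum _ _ _ fun y hy => ?_
    have hyU := hD y (layer_subset ha hU j hy)
    have hsplit := card_filter_add_card_filter_not (s := S y)
      (fun x => IsBranch G m S a (x :: y :: p y))
    suffices #((S y).filter fun x => ¬ IsBranch G m S a (x :: y :: p y)) ≤ K + 1 by omega
    obtain ⟨hb, -⟩ := hp y hy
    cases hpy : p y with
    | nil =>
      rw [hpy] at hb
      rw [filter_false_of_mem]
      · simp
      · intro x hx
        exact not_not.2 ⟨hb, hx⟩
    | cons z t =>
      rw [hpy] at hb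
      refine (card_le_card (t := insert z (shortReturn G m y z)) fun x hx => ?_).trans
        ((card_insert_le _ _).trans (Nat.succ_le_succ (hG y z (hS _ _ hb.tail.1).symm)))
      rw [mem_filter] at hx
      by_contra hcon
      rw [mem_insert, not_or] at hcon
      exact hx.2 ⟨hx.1, hcon.1, hcon.2, hb⟩
  · intro y hy y' hy' hne
    rw [Function.onFun, Finset.disjoint_left]
    intro x hx hx'
    have := IsBranch.unique hS (mem_filter.1 hx).2 (mem_filter.1 hx').2
      (by simp [(hp y hy).2, (hp y' hy').2]) (by simpa [(hp y hy).2] using hj)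
    exact hne (List.cons.inj this).1

theorem pow_le_card_layer (hS : ∀ u, ∀ v ∈ S u, G.Adj u v) {K D j : ℕ} (hG : FewReturns G m K)
    {U : Finset V} (ha : a ∈ U) (hU : ∀ u, S u ⊆ U) (hD : ∀ u ∈ U, D ≤ #(S u))
    (hj : 2 * j ≤ m) :
    (D - (K + 1)) ^ j ≤ #(layer G m S a j) := by
  induction j with
  | zero => simp [layer_zero]
  | succ j ih =>
    rw [pow_succ]
    exact (Nat.mul_le_mul_right _ (ih (by omega))).trans (card_layer_succ_ge hS hG ha hU hD hj)

/-- Let `y` precede a common tip `x` on its branch from `a`. If the branch from `b` passes through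
`y`, then `y` is a common tip one level down. Otherwise fix one such tip `z` above `y`: every other
one is joined to `z` through `b` avoiding `y`, so it is a short return at `yz`. -/
theorem card_layer_inter_succ_le (hS : ∀ u, ∀ v ∈ S u, G.Adj u v) {K D j : ℕ}
    (hG : FewReturns G m K) (hD : ∀ u, #(S u) ≤ D) (hj : 2 * (j + 1) ≤ m) (a b : V) :
    #(layer G m S a (j + 1) ∩ layer G m S b (j + 1)) ≤
      #(layer G m S a j ∩ layer G m S b j) * D + D ^ j * (K + 1) := by
  have hsub : layer G m S a (j + 1) ∩ layer G m S b (j + 1) ⊆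
      (layer G m S a j ∩ layer G m S b j).biUnion S ∪
      (layer G m S a j).biUnion (fun y => (S y).filter fun x =>
        ∃ q, IsBranch G m S b (x :: q) ∧ q.length = j + 1 ∧ y ∉ q) := by
    intro x hx
    obtain ⟨hxa, hxb⟩ := mem_inter.1 hx
    obtain ⟨p, hp, hpj⟩ := mem_layer.1 hxa
    obtain ⟨q, hq, hqj⟩ := mem_layer.1 hxb
    obtain ⟨y, p, rfl⟩ := List.exists_cons_of_length_eq_add_one hpj
    have hya : y ∈ layer G m S a j := mem_layer.2 ⟨p, hp.tail.2, by simpa using hpj⟩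
    by_cases hyq : y ∈ q
    · refine mem_union_left _ (mem_biUnion.2 ⟨y, mem_inter.2 ⟨hya, ?_⟩, hp.tail.1⟩)
      obtain ⟨y', t, rfl⟩ := List.exists_cons_of_length_eq_add_one hqj
      have htj : t.length = j := by simpa using hqj
      suffices y = y' by
        rw [this]
        exact mem_layer.2 ⟨t, hq.tail.2, htj⟩
      -- If `y` came earlier on the branch from `b`, going back from it directly to `x` would avoid
      -- `y'` and make `x` a short return there.
      by_contra hne
      have hyt : y ∈ t := (List.mem_cons.1 hyq).resolve_left hne
      have hy't : y' ∉ t := by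
        intro h
        obtain ⟨s, r, rfl⟩ := List.append_of_mem h
        have hr : IsBranch G m S b (y' :: r) := IsBranch.of_append (s := x :: y' :: s) hq
        have := congrArg List.length
          (IsBranch.unique hS hq.tail.2 hr (by simp; omega) (by omega))
        simp at this
        omega
      cases t with
      | nil => simp at hyt
      | cons z t =>
        obtain ⟨w, hw⟩ := hq.tail.2.tail.2.exists_walk hS
        have hyw : y ∈ w.support := hw ▸ hyt
        have hxy : G.Adj y x := hS _ _ hp.tail.1
        refine hq.2.2.1 (mem_shortReturn.2 ⟨hS _ _ hq.tail.1, hq.2.1,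
          (w.takeUntil y hyw).concat hxy, ?_, ?_⟩)
        · have h1 := w.length_takeUntil_le_length hyw
          rw [length_of_support_eq_cons hw] at h1
          rw [Walk.length_concat]
          rw [List.length_cons] at htj
          omega
        · rw [Walk.support_concat, List.mem_append, List.mem_singleton]
          rintro (h | h)
          · have := w.support_takeUntil_subset_support hyw h
            rw [hw] at this
            exact hy't this
          · exact (hS _ _ hq.tail.1).ne h
    · exact mem_union_right _ (mem_biUnion.2
        ⟨y, hya, mem_filter.2 ⟨hp.tail.1, q, hq, hqj, hyq⟩⟩)
  refine (card_le_card hsub).trans ((card_union_le _ _).trans (Nat.add_le_add ?_ ?_))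
  · exact card_biUnion_le_card_mul _ _ D fun u _ => hD u
  · refine (card_biUnion_le_card_mul _ _ (K + 1) fun y _ => ?_).trans
      (Nat.mul_le_mul_right _ (card_layer_le hD j))
    rcases Finset.eq_empty_or_nonempty ((S y).filter fun x =>
        ∃ q, IsBranch G m S b (x :: q) ∧ q.length = j + 1 ∧ y ∉ q) with h | ⟨z, hz⟩
    · simp [h]
    obtain ⟨hzS, r, hr, hrj, hyr⟩ := mem_filter.1 hz
    have hyz := hS _ _ hzS
    refine (card_le_card (t := insert z (shortReturn G m y z)) fun x hx => ?_).trans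
      ((card_insert_le _ _).trans (Nat.succ_le_succ (hG y z hyz)))
    obtain ⟨hxS, q, hq, hqj, hyq⟩ := mem_filter.1 hx
    rw [mem_insert]
    by_cases hxz : x = z
    · exact Or.inl hxz
    obtain ⟨w, hw⟩ := hr.exists_walk hS
    obtain ⟨w', hw'⟩ := hq.exists_walk hS
    refine Or.inr (mem_shortReturn.2 ⟨hS _ _ hxS, hxz, w.append w'.reverse, ?_, ?_⟩)
    · rw [Walk.length_append, Walk.length_reverse, length_of_support_eq_cons hw,
        length_of_support_eq_cons hw']
      omega
    · rw [Walk.mem_support_append_iff, Walk.support_reverse, List.mem_reverse, hw, hw']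
      have := hyz.ne
      have := (hS _ _ hxS).ne
      simp_all

theorem card_layer_inter_le (hS : ∀ u, ∀ v ∈ S u, G.Adj u v) {K D j : ℕ}
    (hG : FewReturns G m K) (hD : ∀ u, #(S u) ≤ D) (hj : 2 * (j + 1) ≤ m) {a b : V}
    (hab : a ≠ b) :
    #(layer G m S a (j + 1) ∩ layer G m S b (j + 1)) ≤ (j + 1) * (K + 1) * D ^ j := by
  induction j with
  | zero =>
    refine (card_layer_inter_succ_le hS hG hD hj a b).trans ?_
    simp [layer_zero, hab]
  | succ j ih =>
    refine (card_layer_inter_succ_le hS hG hD hj a b).trans ?_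
    have := Nat.mul_le_mul_right D (ih (by omega))
    calc _ ≤ (j + 1) * (K + 1) * D ^ j * D + D ^ (j + 1) * (K + 1) := by omega
      _ = _ := by ring

theorem exists_walk_of_mem_layer_inter (hS : ∀ u, ∀ v ∈ S u, G.Adj u v) {j : ℕ} {a b x : V}
    (hx : x ∈ layer G m S a j ∩ layer G m S b j) : ∃ w : G.Walk a b, w.length = 2 * j := by
  obtain ⟨hxa, hxb⟩ := mem_inter.1 hx
  obtain ⟨p, hp, hpj⟩ := mem_layer.1 hxa
  obtain ⟨q, hq, hqj⟩ := mem_layer.1 hxb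
  obtain ⟨w, hw⟩ := hp.exists_walk hS
  obtain ⟨w', hw'⟩ := hq.exists_walk hS
  refine ⟨w.reverse.append w', ?_⟩
  rw [Walk.length_append, Walk.length_reverse, length_of_support_eq_cons hw,
    length_of_support_eq_cons hw']
  omega

/-! ### Forcing a vertex close to many others -/

/-- Many large sets with small pairwise intersections force a set that meets many others. -/
theorem exists_many_intersecting {W : V → Finset V} {A : Finset V} {E Q : ℕ}
    [Nonempty V]
    (hE : ∀ a ∈ A, E ≤ #(W a)) (hQ : ∀ a ∈ A, ∀ b ∈ A, a ≠ b → #(W a ∩ W b) ≤ Q)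
    (hA : 2 * Fintype.card V ≤ #A * E) :
    ∃ a ∈ A, #A * E ^ 2 ≤
      2 * Fintype.card V * (#(A.filter fun b => a ≠ b ∧ (W a ∩ W b).Nonempty) * Q) := by
  by_contra! hcon
  set n := Fintype.card V with hn
  have hn0 : 0 < n := Fintype.card_pos
  set deg : V → ℕ := fun a => #(A.filter fun b => a ≠ b ∧ (W a ∩ W b).Nonempty) with hdeg
  set I := ∑ a ∈ A, #(W a) with hI
  set c : V → ℕ := fun x => #(A.filter fun a => x ∈ W a) with hc
  have hIc : ∑ x, c x = I := by
    simp only [hc, hI, card_filter]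
    rw [sum_comm]
    refine sum_congr rfl fun a _ => ?_
    rw [← card_filter]
    simp
  have hcc : ∑ x, c x ^ 2 = ∑ a ∈ A, ∑ b ∈ A, #(W a ∩ W b) := by
    have : ∀ a b, #(W a ∩ W b) = ∑ x, (if x ∈ W a then 1 else 0) * (if x ∈ W b then 1 else 0) := by
      intro a b
      simp [← ite_and, inter_comm, ← mem_inter]
    simp only [this]
    simp only [hc, card_filter, sq, sum_mul_sum]
    rw [sum_comm]
    refine sum_congr rfl fun a _ => ?_
    rw [sum_comm]
  have hrow : ∀ a ∈ A, ∑ b ∈ A, #(W a ∩ W b) ≤ #(W a) + deg a * Q := by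
    intro a ha
    rw [← add_sum_erase A _ ha, inter_self]
    refine Nat.add_le_add_left ?_ _
    rw [← sum_filter_add_sum_filter_not (A.erase a) (fun b => (W a ∩ W b).Nonempty)]
    have hzero : ∑ b ∈ (A.erase a).filter (fun b => ¬ (W a ∩ W b).Nonempty), #(W a ∩ W b) = 0 :=
      sum_eq_zero fun b hb => by
        rw [card_eq_zero, ← not_nonempty_iff_eq_empty]
        exact (mem_filter.1 hb).2
    rw [hzero, add_zero]
    refine (sum_le_card_nsmul _ _ Q ?_).trans ?_
    · intro b hb
      obtain ⟨hb, -⟩ := mem_filter.1 hb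
      exact hQ a ha b (mem_of_mem_erase hb) (ne_of_mem_erase hb).symm
    · rw [smul_eq_mul]
      refine Nat.mul_le_mul_right _ (card_le_card fun b hb => ?_)
      simp only [mem_filter, mem_erase] at hb ⊢
      exact ⟨hb.1.2, hb.1.1.symm, hb.2⟩
  have hcs : I ^ 2 ≤ n * ∑ x, c x ^ 2 := by
    rw [← hIc]
    exact sq_sum_le_card_mul_sum_sq
  have h1 : ∑ x, c x ^ 2 ≤ I + ∑ a ∈ A, deg a * Q := by
    rw [hcc, hI, ← sum_add_distrib]
    exact sum_le_sum hrow
  have hIA : #A * E ≤ I := by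
    rw [← smul_eq_mul]
    exact card_nsmul_le_sum _ _ _ hE
  have hAne : A.Nonempty := by
    rw [nonempty_iff_ne_empty]
    rintro rfl
    simp at hA
    omega
  have h2 : ∑ a ∈ A, 2 * n * (deg a * Q) < #A * (#A * E ^ 2) := by
    rw [← smul_eq_mul (#A), ← sum_const]
    exact sum_lt_sum_of_nonempty hAne hcon
  rw [← mul_sum] at h2
  have h3 : (#A * E) ^ 2 ≤ I ^ 2 := Nat.pow_le_pow_left hIA 2
  -- Cauchy–Schwarz gives `I² ≤ n * (I + ∑ deg * Q)`. As `2n ≤ I`, the diagonal term `n * I` is at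
  -- most half of `I²` and is absorbed.
  nlinarith [Nat.mul_le_mul_left n h1, Nat.mul_le_mul_right I (hA.trans hIA)]

end

section
open scoped Classical
open Finset SimpleGraph

variable {V : Type*} [Fintype V]

theorem FewReturns.exists_many_close {G : SimpleGraph V} {j K D : ℕ}
    (hG : FewReturns G (2 * (j + 1)) K) {U : Finset V} (hU : ∀ u v, G.Adj u v → v ∈ U)
    (hD : ∀ u ∈ U, D ≤ #(univ.filter (G.Adj u))) {A : Finset V} (hAU : A ⊆ U) [Nonempty V]
    (hA : 2 * Fintype.card V ≤ #A * (D - (K + 1)) ^ (j + 1)) :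
    ∃ a ∈ A, #A * ((D - (K + 1)) ^ (j + 1)) ^ 2 ≤ 2 * Fintype.card V *
      (#(A.filter fun b => a ≠ b ∧ ∃ w : G.Walk a b, w.length ≤ 2 * (j + 1)) *
        ((j + 1) * (K + 1) * D ^ j)) := by
  -- Degrees are bounded only from below; keeping exactly `D` neighbours gives the upper bounds on
  -- layer intersections too.
  have h : ∀ u, ∃ s : Finset V, s ⊆ univ.filter (G.Adj u) ∧ #s ≤ D ∧ (u ∈ U → D ≤ #s) := by
    intro u
    by_cases hu : u ∈ U
    · obtain ⟨s, hs, hsD⟩ := exists_subset_card_eq (hD u hu)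
      exact ⟨s, hs, hsD.le, fun _ => hsD.ge⟩
    · exact ⟨∅, empty_subset _, by simp, fun h => absurd h hu⟩
  choose S hS hSD hSU using h
  have hadj : ∀ u, ∀ v ∈ S u, G.Adj u v := fun u v hv => (mem_filter.1 (hS u hv)).2
  obtain ⟨a, ha, h⟩ := exists_many_intersecting
    (W := fun a => layer G (2 * (j + 1)) S a (j + 1)) (A := A)
    (fun a ha => pow_le_card_layer hadj hG (hAU ha) (fun u v hv => hU u v (hadj u v hv))
      hSU le_rfl)
    (fun a _ b _ hab => card_layer_inter_le hadj hG hSD le_rfl hab) hA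
  refine ⟨a, ha, h.trans (Nat.mul_le_mul_left _ (Nat.mul_le_mul_right _ (card_le_card ?_)))⟩
  refine monotone_filter_right _ fun b _ hb => ⟨hb.1, ?_⟩
  obtain ⟨x, hx⟩ := hb.2
  obtain ⟨w, hw⟩ := exists_walk_of_mem_layer_inter hadj hx
  exact ⟨w, hw.le⟩

/-! ### Fingerprints and containers -/

/-- If every subset of `U` with more than `R` elements contains a vertex related to a proportion
`1 / b` of it, then every set is captured by a small fingerprint, the elements related to the
fingerprint, and a container of size at most `R` determined by the fingerprint. -/
theorem exists_containers {r : V → V → Prop} {U : Finset V} {R b : ℝ} (hb : 1 ≤ b)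
    (h : ∀ A ⊆ U, R < #A → ∃ a ∈ A, (#A : ℝ) ≤ b * #(A.filter fun x => a ≠ x ∧ r a x))
    (q : ℕ) (A : Finset V) (hA : A ⊆ U) (hq : (1 - 1 / b) ^ q * #A < 1) :
    ∃ C : Finset V → Finset V, (∀ T, (#(C T) : ℝ) ≤ R) ∧ ∀ I : Finset V,
      ∃ T ⊆ I ∩ A, #T ≤ q ∧
        I ∩ A ⊆ T ∪ (I.filter fun x => ∃ t ∈ T, t ≠ x ∧ r t x) ∪ C T := by
  have hb0 : 0 < b := by linarith
  have hb1 : 0 ≤ 1 - 1 / b := by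
    rw [sub_nonneg, div_le_one hb0]
    exact hb
  induction A using Finset.strongInduction generalizing q with
  | H A ih =>
  by_cases hAR : (#A : ℝ) ≤ R
  · refine ⟨fun _ => A, fun _ => hAR, fun I => ⟨∅, empty_subset _, by simp, ?_⟩⟩
    exact inter_subset_right.trans subset_union_right
  obtain ⟨a, ha, hdeg⟩ := h A hA (not_le.1 hAR)
  set N := A.filter fun x => a ≠ x ∧ r a x with hN
  have hNA : N ⊆ A := filter_subset _ _
  have hq0 : q ≠ 0 := by
    rintro rfl
    have : #A = 0 := by
      rw [pow_zero, one_mul] at hq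
      exact Nat.lt_one_iff.1 (by exact_mod_cast hq)
    rw [card_eq_zero] at this
    simp [this] at ha
  obtain ⟨q, rfl⟩ := Nat.exists_eq_succ_of_ne_zero hq0
  have hsub1 : A.erase a ⊂ A := erase_ssubset ha
  have hsub2 : (A \ N).erase a ⊂ A :=
    (erase_subset_erase _ sdiff_subset).trans_ssubset hsub1
  have hq1 : (1 - 1 / b) ^ (q + 1) * #(A.erase a) < 1 :=
    (mul_le_mul_of_nonneg_left (by exact_mod_cast card_le_card hsub1.subset)
      (pow_nonneg hb1 _)).trans_lt hq
  -- Discarding `N` shrinks `A` by the factor `1 - 1 / b`, which pays for one fingerprint element.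
  have hq2 : (1 - 1 / b) ^ q * #((A \ N).erase a) < 1 := by
    refine lt_of_le_of_lt ?_ hq
    rw [pow_succ, mul_assoc]
    refine mul_le_mul_of_nonneg_left ?_ (pow_nonneg hb1 _)
    have h1 : (#((A \ N).erase a) : ℝ) ≤ #(A \ N) := by exact_mod_cast card_erase_le
    have h2 : (#(A \ N) : ℝ) = #A - #N := by
      rw [card_sdiff_of_subset hNA, Nat.cast_sub (card_le_card hNA)]
    have h3 : (#A : ℝ) / b ≤ #N := (div_le_iff₀' hb0).2 hdeg
    have h4 : (1 - 1 / b) * (#A : ℝ) = #A - #A / b := by ring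
    linarith
  obtain ⟨C1, hC1, hI1⟩ := ih _ hsub1 (q + 1) (hsub1.subset.trans hA) hq1
  obtain ⟨C2, hC2, hI2⟩ := ih _ hsub2 q (hsub2.subset.trans hA) hq2
  -- Neither recursive fingerprint contains `a`, so `a ∈ T` records whether `a ∈ I`, and the
  -- container depends on `T` alone.
  refine ⟨fun T => if a ∈ T then C2 (T.erase a) else C1 T, fun T => ?_, fun I => ?_⟩
  · dsimp only
    split_ifs
    · exact hC2 _
    · exact hC1 _
  by_cases haI : a ∈ I
  · obtain ⟨T, hT, hTq, hTI⟩ := hI2 I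
    have haT : a ∉ T := fun h => notMem_erase a _ (mem_inter.1 (hT h)).2
    refine ⟨insert a T, ?_, (card_insert_le _ _).trans (Nat.succ_le_succ hTq), ?_⟩
    · refine insert_subset (mem_inter.2 ⟨haI, ha⟩) fun x hx => ?_
      obtain ⟨h1, h2⟩ := mem_inter.1 (hT hx)
      exact mem_inter.2 ⟨h1, hsub2.subset h2⟩
    · dsimp only
      rw [if_pos (mem_insert_self _ _), erase_insert haT]
      intro x hx
      obtain ⟨hxI, hxA⟩ := mem_inter.1 hx
      by_cases hxa : x = a
      · simp [hxa]
      by_cases hxN : x ∈ N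
      · refine mem_union_left _ (mem_union_right _ (mem_filter.2 ⟨hxI, a, mem_insert_self _ _, ?_⟩))
        exact (mem_filter.1 hxN).2
      have := hTI (mem_inter.2 ⟨hxI, mem_erase.2 ⟨hxa, mem_sdiff.2 ⟨hxA, hxN⟩⟩⟩)
      simp only [mem_union, mem_filter, mem_insert] at this ⊢
      rcases this with (h | ⟨h1, t, h2, h3⟩) | h
      · exact Or.inl (Or.inl (Or.inr h))
      · exact Or.inl (Or.inr ⟨h1, t, Or.inr h2, h3⟩)
      · exact Or.inr h
  · obtain ⟨T, hT, hTq, hTI⟩ := hI1 I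
    have haT : a ∉ T := fun h => notMem_erase a _ (mem_inter.1 (hT h)).2
    refine ⟨T, fun x hx => ?_, hTq, ?_⟩
    · obtain ⟨h1, h2⟩ := mem_inter.1 (hT hx)
      exact mem_inter.2 ⟨h1, hsub1.subset h2⟩
    · dsimp only
      rw [if_neg haT]
      intro x hx
      obtain ⟨hxI, hxA⟩ := mem_inter.1 hx
      exact hTI (mem_inter.2 ⟨hxI, mem_erase.2 ⟨fun h => haI (h ▸ hxI), hxA⟩⟩)

theorem card_filter_card_le (q : ℕ) :
    #(univ.filter fun T : Finset V => #T ≤ q) ≤ (Fintype.card V + 1) ^ q := by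
  induction q with
  | zero =>
    rw [pow_zero, card_le_one]
    simp
  | succ q ih =>
    have : (univ.filter fun T : Finset V => #T ≤ q + 1) ⊆
        ((univ.filter fun T : Finset V => #T ≤ q) ×ˢ (univ : Finset (Option V))).image
          fun p => p.2.elim p.1 fun v => insert v p.1 := by
      intro T hT
      rw [mem_filter] at hT
      rw [mem_image]
      rcases T.eq_empty_or_nonempty with rfl | ⟨v, hv⟩
      · exact ⟨(∅, none), by simp, rfl⟩
      · refine ⟨(T.erase v, some v), ?_, insert_erase hv⟩
        have := card_erase_of_mem hv
        simp only [mem_product, mem_filter, mem_univ, true_and, and_true]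
        omega
    refine (card_le_card this).trans (card_image_le.trans ?_)
    rw [card_product, pow_succ, card_univ, Fintype.card_option]
    exact Nat.mul_le_mul_right _ ih

/-- The number of sets that are locally sparse for a relation admitting containers. -/
theorem card_sparse_le_of_containers {r : V → V → Prop} {U : Finset V} {R b : ℝ} (hb : 1 ≤ b)
    (h : ∀ A ⊆ U, R < #A → ∃ a ∈ A, (#A : ℝ) ≤ b * #(A.filter fun x => a ≠ x ∧ r a x))
    {q : ℕ} (hq : (1 - 1 / b) ^ q * #U < 1) {d K P : ℕ}
    (hP : ∀ C : Finset V, (#C : ℝ) ≤ R → #(C.powerset.filter fun J => #J ≤ d) ≤ P) :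
    #(univ.filter fun I : Finset V => I ⊆ U ∧ #I = d ∧
      ∀ a ∈ I, #(I.filter fun x => a ≠ x ∧ r a x) ≤ K) ≤
      (Fintype.card V + 1) ^ ((K + 1) * q) * P := by
  obtain ⟨C, hC, hI⟩ := exists_containers hb h q U subset_rfl hq
  have hsub : (univ.filter fun I : Finset V => I ⊆ U ∧ #I = d ∧
      ∀ a ∈ I, #(I.filter fun x => a ≠ x ∧ r a x) ≤ K) ⊆
      ((univ.filter fun T : Finset V => #T ≤ q) ×ˢ
        (univ.filter fun J : Finset V => #J ≤ q * K)).biUnion fun p =>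
          (((C p.1).powerset.filter fun J => #J ≤ d).image fun Y => p.1 ∪ p.2 ∪ Y) := by
    intro I hI'
    obtain ⟨-, hIU, hId, hIK⟩ := mem_filter.1 hI'
    obtain ⟨T, hT, hTq, hTI⟩ := hI I
    rw [inter_eq_left.2 hIU] at hT hTI
    rw [mem_biUnion]
    refine ⟨(T, I.filter fun x => ∃ t ∈ T, t ≠ x ∧ r t x), ?_, ?_⟩
    · simp only [mem_product, mem_filter, mem_univ, true_and]
      refine ⟨hTq, ?_⟩
      have : (I.filter fun x => ∃ t ∈ T, t ≠ x ∧ r t x) ⊆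
          T.biUnion fun t => I.filter fun x => t ≠ x ∧ r t x := by
        intro x hx
        obtain ⟨hxI, t, ht, hx⟩ := mem_filter.1 hx
        exact mem_biUnion.2 ⟨t, ht, mem_filter.2 ⟨hxI, hx⟩⟩
      refine (card_le_card this).trans ?_
      refine (card_biUnion_le_card_mul _ _ K fun t ht => hIK t (hT ht)).trans ?_
      exact Nat.mul_le_mul_right _ hTq
    · rw [mem_image]
      refine ⟨I ∩ C T, mem_filter.2 ⟨mem_powerset.2 inter_subset_right,
        hId ▸ card_le_card inter_subset_left⟩, ?_⟩
      apply subset_antisymm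
      · exact union_subset (union_subset hT (filter_subset _ _)) inter_subset_left
      · intro x hx
        have := hTI hx
        rw [mem_union] at this ⊢
        exact this.imp_right fun h => mem_inter.2 ⟨hx, h⟩
  refine (card_le_card hsub).trans ((card_biUnion_le_card_mul _ _ P fun p _ => ?_).trans
    (Nat.mul_le_mul_right _ ?_))
  · exact card_image_le.trans (hP _ (hC _))
  · rw [card_product, show (K + 1) * q = q + q * K by ring, pow_add]
    exact Nat.mul_le_mul (card_filter_card_le _) (card_filter_card_le _)

/-- Weight each subset `J` by `t ^ #J ≥ t ^ d` and sum with the binomial theorem. -/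
theorem card_powerset_filter_card_le_mul_pow {V : Type*} (C : Finset V) (d : ℕ) {t : ℝ} (ht0 : 0 ≤ t)
    (ht1 : t ≤ 1) :
    (#(C.powerset.filter fun J => #J ≤ d) : ℝ) * t ^ d ≤ (1 + t) ^ #C := by
  calc (#(C.powerset.filter fun J => #J ≤ d) : ℝ) * t ^ d
      = ∑ J ∈ C.powerset.filter fun J => #J ≤ d, t ^ d := by rw [sum_const, nsmul_eq_mul]
    _ ≤ ∑ J ∈ C.powerset.filter fun J => #J ≤ d, t ^ #J :=
        sum_le_sum fun J hJ => pow_le_pow_of_le_one ht0 ht1 (mem_filter.1 hJ).2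
    _ ≤ ∑ J ∈ C.powerset, t ^ #J :=
        sum_le_sum_of_subset_of_nonneg (filter_subset _ _) fun J _ _ => pow_nonneg ht0 _
    _ = (1 + t) ^ #C := by
        rw [add_comm 1 t, ← sum_pow_mul_eq_add_pow]
        simp

theorem card_powerset_filter_card_le_exp {V : Type*} {C : Finset V} {d ℓ : ℕ} (hd : 1 ≤ d) (hℓ : 1 ≤ ℓ)
    {x : ℝ} (hx : 0 < x) (hC : (#C : ℝ) * (d : ℝ) ^ (ℓ - 1) ≤ (2 * x) ^ ℓ) :
    (#(C.powerset.filter fun J => #J ≤ d) : ℝ) ≤ Real.exp (2 * ℓ * x) := by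
  obtain ⟨k, rfl⟩ := Nat.exists_eq_add_of_le' hℓ
  rw [Nat.add_sub_cancel] at hC
  have hd0 : (0 : ℝ) < d := by exact_mod_cast hd
  push_cast
  rcases le_total (2 * x) d with hxd | hxd
  · have h1 : (#C : ℝ) ≤ 2 * x := by
      have h2 : (2 * x) ^ (k + 1) ≤ 2 * x * (d : ℝ) ^ k := by
        rw [pow_succ']
        exact mul_le_mul_of_nonneg_left (pow_le_pow_left₀ (by positivity) hxd k) (by positivity)
      exact le_of_mul_le_mul_right (hC.trans h2) (pow_pos hd0 k)
    have h3 := card_powerset_filter_card_le_mul_pow C d zero_le_one le_rfl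
    rw [one_pow, mul_one] at h3
    refine h3.trans ((pow_le_pow_left₀ (by norm_num) (Real.add_one_le_exp 1 |>.trans' (by norm_num))
      _).trans ?_)
    rw [← Real.exp_nat_mul, Real.exp_le_exp]
    have : (0 : ℝ) ≤ k * x := by positivity
    nlinarith
  -- The weight `t = u^ℓ` gives `#C * t ≤ d`, so the count is at most `e^d * u^(-ℓd)`; then `u⁻¹ ≤
  -- e^(u⁻¹ - 1)` bounds the second factor by `e^(ℓ(2x - d))`.
  · set u : ℝ := d / (2 * x) with hu
    have hu0 : 0 < u := by positivity
    have hu1 : u ≤ 1 := (div_le_one (by positivity)).2 hxd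
    have h1 := card_powerset_filter_card_le_mul_pow C d (pow_nonneg hu0.le (k + 1))
      (pow_le_one₀ hu0.le hu1)
    have h2 : (1 + u ^ (k + 1)) ^ #C ≤ Real.exp d := by
      have h3 : 1 + u ^ (k + 1) ≤ Real.exp (u ^ (k + 1)) := by
        linarith [Real.add_one_le_exp (u ^ (k + 1))]
      refine (pow_le_pow_left₀ (by positivity) h3 _).trans ?_
      rw [← Real.exp_nat_mul, Real.exp_le_exp, hu, div_pow, ← mul_div_assoc,
        div_le_iff₀ (by positivity), pow_succ (d : ℝ) k, ← mul_assoc, mul_comm (d : ℝ)]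
      exact mul_le_mul_of_nonneg_right hC hd0.le
    have h4 : 1 ≤ (u ^ (k + 1)) ^ d * Real.exp ((k + 1) * (2 * x - d)) := by
      have h5 : 1 ≤ u * Real.exp (u⁻¹ - 1) := by
        have := Real.add_one_le_exp (u⁻¹ - 1)
        rw [sub_add_cancel] at this
        calc 1 = u * u⁻¹ := (mul_inv_cancel₀ hu0.ne').symm
          _ ≤ _ := mul_le_mul_of_nonneg_left this hu0.le
      have h6 : (k + 1) * (2 * x - d) = (((k + 1) * d : ℕ) : ℝ) * (u⁻¹ - 1) := by
        rw [hu]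
        push_cast
        field_simp
      rw [h6, Real.exp_nat_mul, ← pow_mul, ← mul_pow]
      exact one_le_pow₀ h5
    set s : ℝ := (#(C.powerset.filter fun J => #J ≤ d) : ℝ) with hs
    calc s ≤ s * ((u ^ (k + 1)) ^ d * Real.exp ((k + 1) * (2 * x - d))) :=
          le_mul_of_one_le_right (by positivity) h4
      _ = s * (u ^ (k + 1)) ^ d * Real.exp ((k + 1) * (2 * x - d)) := by ring
      _ ≤ Real.exp d * Real.exp ((k + 1) * (2 * x - d)) :=
          mul_le_mul_of_nonneg_right (h1.trans h2) (Real.exp_pos _).le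
      _ ≤ _ := by
          rw [← Real.exp_add, Real.exp_le_exp]
          have : (0 : ℝ) ≤ k * d := by positivity
          nlinarith

end

/-! ### Counting the possible neighbourhoods of a deleted vertex -/

section
open scoped Classical
open Finset SimpleGraph

variable {V : Type*} [Fintype V]

/-- The `d`-element subsets of `U` that contain few pairs joined by a short walk of `G`. -/
noncomputable def sparseSubsets (G : SimpleGraph V) (m K : ℕ) (U : Finset V) (d : ℕ) :
    Finset (Finset V) :=
  univ.filter fun I => I ⊆ U ∧ #I = d ∧
    ∀ a ∈ I, #(I.filter fun x => a ≠ x ∧ ∃ w : G.Walk a x, w.length ≤ m) ≤ K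

/-- The constant 3 of the theorem comes from `2 ≤ 3 * log 2`. -/
theorem exp_two_le_two_rpow_three {y : ℝ} (hy : 0 ≤ y) : Real.exp (2 * y) ≤ (2 : ℝ) ^ (3 * y) := by
  rw [Real.rpow_def_of_pos two_pos, Real.exp_le_exp]
  nlinarith [Real.log_two_gt_d9]

/-- In the intersection bound the powers of `d` leave the ratio `n / d^(j+2)`, which is at most
`Λ^(j+2)` because `x ≤ Λ * d`. -/
theorem FewReturns.exists_dense_vertex {G : SimpleGraph V} {j K d : ℕ}
    (hG : FewReturns G (2 * (j + 1)) K) {U : Finset V} (hU : ∀ u v, G.Adj u v → v ∈ U)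
    (hD : ∀ u ∈ U, d ≤ #(univ.filter (G.Adj u)) + 1) [Nonempty V] {x Λ : ℝ}
    (hx : x ^ (j + 2) = Fintype.card V) (hx0 : 0 < x)
    (hd : x ≤ Λ * d) (hdK : 2 * K + 4 ≤ d) {A : Finset V} (hAU : A ⊆ U)
    (hA : (2 * x) ^ (j + 2) / (d : ℝ) ^ (j + 1) < #A) :
    ∃ a ∈ A, (#A : ℝ) ≤ (2 * 4 ^ (j + 1) * ((j + 1) * (K + 1)) * Λ ^ (j + 2)) *
      #(A.filter fun b => a ≠ b ∧ ∃ w : G.Walk a b, w.length ≤ 2 * (j + 1)) := by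
  have hd0 : (0 : ℝ) < d := by
    have : 0 < d := by omega
    exact_mod_cast this
  have hE : (d : ℝ) / 2 ≤ ((d - 1 - (K + 1) : ℕ) : ℝ) := by
    rw [div_le_iff₀ two_pos]
    exact_mod_cast (by omega : d ≤ (d - 1 - (K + 1)) * 2)
  have hEp : ((d : ℝ) / 2) ^ (j + 1) ≤ (((d - 1 - (K + 1)) ^ (j + 1) : ℕ) : ℝ) := by
    push_cast
    exact pow_le_pow_left₀ (by positivity) hE _
  -- The threshold on `#A` is exactly what this needs: `(2x)^(j+2) = 2n * 2^(j+1)`, the last factor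
  -- paying for halving `d`.
  have hlarge : 2 * Fintype.card V ≤ #A * (d - 1 - (K + 1)) ^ (j + 1) := by
    rw [div_lt_iff₀ (by positivity)] at hA
    have h1 : (2 * Fintype.card V : ℝ) ≤ #A * ((d : ℝ) / 2) ^ (j + 1) := by
      rw [← hx, div_pow, mul_div_assoc', le_div_iff₀ (by positivity)]
      refine le_trans (le_of_eq ?_) hA.le
      ring
    exact_mod_cast h1.trans (mul_le_mul_of_nonneg_left hEp (by positivity))
  obtain ⟨a, ha, h⟩ := hG.exists_many_close hU
    (fun u hu => Nat.sub_le_iff_le_add.2 (hD u hu)) hAU hlarge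
  refine ⟨a, ha, ?_⟩
  set g := #(A.filter fun b => a ≠ b ∧ ∃ w : G.Walk a b, w.length ≤ 2 * (j + 1))
  have h1 : (#A : ℝ) * (((d : ℝ) / 2) ^ (j + 1)) ^ 2 ≤
      2 * x ^ (j + 2) * (g * ((j + 1) * (K + 1) * (d : ℝ) ^ j)) := by
    calc _ ≤ (#A : ℝ) * (((d - 1 - (K + 1)) ^ (j + 1) : ℕ) : ℝ) ^ 2 := by gcongr
      _ ≤ ((2 * Fintype.card V * (g * ((j + 1) * (K + 1) * (d - 1) ^ j)) : ℕ) : ℝ) := by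
          exact_mod_cast h
      _ ≤ _ := by
          rw [hx]
          push_cast
          gcongr
          exact_mod_cast Nat.sub_le d 1
  have h2 : x ^ (j + 2) ≤ (Λ * d) ^ (j + 2) := pow_le_pow_left₀ hx0.le hd _
  have h3 : (#A : ℝ) * (((d : ℝ) / 2) ^ (j + 1)) ^ 2 ≤
      2 * (Λ * d) ^ (j + 2) * (g * ((j + 1) * (K + 1) * (d : ℝ) ^ j)) := by
    refine h1.trans ?_
    gcongr
  have h4 : (((d : ℝ) / 2) ^ (j + 1)) ^ 2 = (d : ℝ) ^ (2 * j + 2) / 4 ^ (j + 1) := by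
    rw [← pow_mul, div_pow, show (4 : ℝ) = 2 ^ 2 by norm_num, ← pow_mul]
    congr 2 <;> ring
  rw [h4, mul_div_assoc', div_le_iff₀ (by positivity)] at h3
  refine le_of_mul_le_mul_right (h3.trans (le_of_eq ?_)) (pow_pos hd0 (2 * j + 2))
  ring

theorem card_sparseSubsets_le {G : SimpleGraph V} {j K d q : ℕ}
    (hG : FewReturns G (2 * (j + 1)) K) {U : Finset V} (hU : ∀ u v, G.Adj u v → v ∈ U)
    (hD : ∀ u ∈ U, d ≤ #(univ.filter (G.Adj u)) + 1) [Nonempty V] {x Λ : ℝ}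
    (hx : x ^ (j + 2) = Fintype.card V) (hx0 : 0 < x) (hΛ : 1 ≤ Λ)
    (hΛV : (Fintype.card V + 1 : ℝ) = 2 ^ Λ) (hxΛ : Λ * (2 * K + 4) ≤ x)
    (hq : (1 - 1 / (2 * 4 ^ (j + 1) * ((j + 1) * (K + 1)) * Λ ^ (j + 2))) ^ q *
      Fintype.card V < 1) :
    (#(sparseSubsets G (2 * (j + 1)) K U d) : ℝ) ≤
      (2 : ℝ) ^ (Λ * ((K + 1) * q) + 3 * ((j + 2) * x)) := by
  have hΛ0 : 0 < Λ := by linarith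
  -- For small `d` all sets of at most `d` vertices are counted, giving `2^(Λd) ≤ 2^x`; only large
  -- `d` needs containers.
  rcases le_or_gt (Λ * d) x with hd | hd
  · have h1 : #(sparseSubsets G (2 * (j + 1)) K U d) ≤ (Fintype.card V + 1) ^ d :=
      (card_le_card (monotone_filter_right _ fun I _ hI => hI.2.1.le)).trans
        (card_filter_card_le d)
    calc (#(sparseSubsets G (2 * (j + 1)) K U d) : ℝ) ≤ (Fintype.card V + 1 : ℝ) ^ d := by
          exact_mod_cast h1
      _ = (2 : ℝ) ^ (Λ * d) := by
          rw [hΛV, ← Real.rpow_natCast, ← Real.rpow_mul two_pos.le]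
      _ ≤ _ := by
          refine Real.rpow_le_rpow_of_exponent_le one_le_two ?_
          have : 0 ≤ Λ * ((K + 1) * q) := by positivity
          have : 0 ≤ (j : ℝ) * x := by positivity
          linarith
  have hdK : 2 * K + 4 ≤ d := by
    have : (2 * K + 4 : ℝ) ≤ d := le_of_mul_le_mul_left (hxΛ.trans hd.le) hΛ0
    exact_mod_cast this
  have hd0 : (0 : ℝ) < d := by
    have : 0 < d := by omega
    exact_mod_cast this
  have hb : 1 ≤ 2 * 4 ^ (j + 1) * ((j + 1) * (K + 1)) * Λ ^ (j + 2) := by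
    have h1 : (1 : ℝ) ≤ 4 ^ (j + 1) := one_le_pow₀ (by norm_num)
    have h2 : 1 ≤ Λ ^ (j + 2) := one_le_pow₀ hΛ
    have h3 : (1 : ℝ) ≤ (j + 1) * (K + 1) :=
      one_le_mul_of_one_le_of_one_le (by simp) (by simp)
    refine one_le_mul_of_one_le_of_one_le (one_le_mul_of_one_le_of_one_le ?_ h3) h2
    linarith
  have hb1 : 0 ≤ 1 - 1 / (2 * 4 ^ (j + 1) * ((j + 1) * (K + 1)) * Λ ^ (j + 2)) := by
    rw [sub_nonneg, div_le_one (by linarith)]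
    exact hb
  have hqU : (1 - 1 / (2 * 4 ^ (j + 1) * ((j + 1) * (K + 1)) * Λ ^ (j + 2))) ^ q * #U < 1 :=
    (mul_le_mul_of_nonneg_left (by exact_mod_cast card_le_univ U) (pow_nonneg hb1 q)).trans_lt hq
  have h := card_sparse_le_of_containers
    (r := fun a b => ∃ w : G.Walk a b, w.length ≤ 2 * (j + 1)) (U := U)
    (R := (2 * x) ^ (j + 2) / (d : ℝ) ^ (j + 1)) hb
    (fun A hAU hA => hG.exists_dense_vertex hU hD hx hx0 hd.le hdK hAU hA) hqU (d := d) (K := K)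
    (P := ⌊(2 : ℝ) ^ (3 * ((j + 2) * x))⌋₊) (by
      intro C hC
      rw [le_div_iff₀ (by positivity)] at hC
      refine Nat.le_floor ((card_powerset_filter_card_le_exp (ℓ := j + 2) (by omega) (by omega)
        hx0 hC).trans ?_)
      have := exp_two_le_two_rpow_three (y := (j + 2) * x) (by positivity)
      push_cast
      rwa [← mul_assoc] at this)
  calc (#(sparseSubsets G (2 * (j + 1)) K U d) : ℝ)
      ≤ (Fintype.card V + 1 : ℝ) ^ ((K + 1) * q) * ⌊(2 : ℝ) ^ (3 * ((j + 2) * x))⌋₊ := by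
        exact_mod_cast h
    _ ≤ (Fintype.card V + 1 : ℝ) ^ ((K + 1) * q) * (2 : ℝ) ^ (3 * ((j + 2) * x)) := by
        gcongr
        exact Nat.floor_le (by positivity)
    _ = _ := by
        rw [hΛV, ← Real.rpow_natCast, ← Real.rpow_mul two_pos.le, ← Real.rpow_add two_pos]
        push_cast
        rfl

/-! ### Peeling off vertices of minimum degree -/

/-- The graphs with few short returns whose edges all lie inside `U`. -/
noncomputable def fewReturnsOn (m K : ℕ) (U : Finset V) : Finset (SimpleGraph V) :=
  univ.filter fun G => FewReturns G m K ∧ ∀ u v, G.Adj u v → v ∈ U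

theorem mem_fewReturnsOn {m K : ℕ} {U : Finset V} {G : SimpleGraph V} :
    G ∈ fewReturnsOn m K U ↔ FewReturns G m K ∧ ∀ u v, G.Adj u v → v ∈ U := by
  simp [fewReturnsOn]

theorem fewReturnsOn_empty (m K : ℕ) : #(fewReturnsOn (V := V) m K ∅) ≤ 1 := by
  refine card_le_one.2 fun G hG G' hG' => ?_
  have h : ∀ G ∈ fewReturnsOn (V := V) m K ∅, G = ⊥ := by
    intro G hG
    ext u v
    simpa using (mem_filter.1 hG).2.2 u v
  rw [h G hG, h G' hG']

theorem FewReturns.neighbors_mem_sparseSubsets {G : SimpleGraph V} {m K : ℕ}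
    (hG : FewReturns G m K) {U : Finset V} (hU : ∀ u v, G.Adj u v → v ∈ U) (v : V) :
    univ.filter (G.Adj v) ∈ sparseSubsets (G.deleteIncidenceSet v) m K (U.erase v)
      #(univ.filter (G.Adj v)) := by
  refine mem_filter.2 ⟨mem_univ _, fun u hu => ?_, rfl, fun a ha => ?_⟩
  · have := (mem_filter.1 hu).2
    exact mem_erase.2 ⟨this.ne', hU v u this⟩
  have hva : G.Adj v a := (mem_filter.1 ha).2
  refine (card_le_card fun x hx => ?_).trans (hG v a hva)
  obtain ⟨hx, hax, w, hw⟩ := mem_filter.1 hx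
  refine mem_shortReturn.2 ⟨(mem_filter.1 hx).2, hax.symm, w.mapLe (G.deleteIncidenceSet_le v),
    by simpa using hw, fun hv => ?_⟩
  have hv' : v ∈ w.support := by simpa using hv
  -- As `v` is isolated after the deletion, no walk starting at `a ≠ v` can reach it.
  cases hw' : (w.takeUntil v hv').reverse with
  | nil => exact hva.ne rfl
  | cons h p => exact (G.deleteIncidenceSet_adj.1 h).2.1 rfl

/-- A vertex `v` of minimum degree `d` is removed. The choices of `v` and `d` cost `(n + 1)^2`, the
neighbourhood costs `B`. Each other degree drops by at most one, hence the `+ 1` in the degree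
hypothesis. -/
theorem card_fewReturnsOn_le {m K : ℕ} {B : ℕ}
    (hB : ∀ (G : SimpleGraph V) (U : Finset V) (d : ℕ), FewReturns G m K →
      (∀ u v, G.Adj u v → v ∈ U) → (∀ u ∈ U, d ≤ #(univ.filter (G.Adj u)) + 1) →
      #(sparseSubsets G m K U d) ≤ B) (U : Finset V) :
    #(fewReturnsOn m K U) ≤ ((Fintype.card V + 1) ^ 2 * B) ^ #U := by
  induction hc : #U generalizing U with
  | zero =>
    rw [card_eq_zero.1 hc, pow_zero]
    exact fewReturnsOn_empty m K
  | succ c ih =>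
    have hUne : U.Nonempty := card_pos.1 (by omega)
    have hsub : fewReturnsOn m K U ⊆ U.biUnion fun v =>
        (fewReturnsOn m K (U.erase v)).biUnion fun G' =>
          ((range (Fintype.card V + 1)).filter fun d =>
            ∀ u ∈ U.erase v, d ≤ #(univ.filter (G'.Adj u)) + 1).biUnion fun d =>
              (sparseSubsets G' m K (U.erase v) d).image fun I =>
                G' ⊔ SimpleGraph.fromRel fun x y => x = v ∧ y ∈ I := by
      intro G hG
      obtain ⟨-, hGK, hGU⟩ := mem_filter.1 hG
      obtain ⟨v, hv, hmin⟩ := exists_min_image U (fun u => #(univ.filter (G.Adj u))) hUne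
      refine mem_biUnion.2 ⟨v, hv, mem_biUnion.2 ⟨G.deleteIncidenceSet v, ?_, mem_biUnion.2
        ⟨#(univ.filter (G.Adj v)), ?_, mem_image.2 ⟨_, hGK.neighbors_mem_sparseSubsets hGU v, ?_⟩⟩⟩⟩
      · refine mem_filter.2 ⟨mem_univ _, hGK.mono (G.deleteIncidenceSet_le v), fun u w h => ?_⟩
        obtain ⟨h1, -, h2⟩ := G.deleteIncidenceSet_adj.1 h
        exact mem_erase.2 ⟨h2, hGU _ _ h1⟩
      · refine mem_filter.2 ⟨mem_range.2 (Nat.lt_succ_of_le (card_le_univ _)), fun u hu => ?_⟩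
        obtain ⟨huv, hu⟩ := mem_erase.1 hu
        refine (hmin u hu).trans ((card_le_card fun w hw => ?_).trans (card_insert_le v _))
        simp only [mem_insert, mem_filter, mem_univ, true_and, deleteIncidenceSet_adj]
        by_cases hwv : w = v
        · exact Or.inl hwv
        · exact Or.inr ⟨(mem_filter.1 hw).2, huv, hwv⟩
      · ext x y
        rw [sup_adj, G.deleteIncidenceSet_adj, fromRel_adj]
        simp only [mem_filter, mem_univ, true_and]
        constructor
        · rintro (h | ⟨-, ⟨rfl, h⟩ | ⟨rfl, h⟩⟩)
          · exact h.1
          · exact h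
          · exact h.symm
        · intro h
          by_cases hxv : x = v
          · exact Or.inr ⟨h.ne, Or.inl ⟨hxv, hxv ▸ h⟩⟩
          by_cases hyv : y = v
          · exact Or.inr ⟨h.ne, Or.inr ⟨hyv, hyv ▸ h.symm⟩⟩
          · exact Or.inl ⟨h, hxv, hyv⟩
    calc #(fewReturnsOn m K U) ≤ _ := card_le_card hsub
      _ ≤ #U * (((Fintype.card V + 1) ^ 2 * B) ^ c * ((Fintype.card V + 1) * B)) := by
          refine card_biUnion_le_card_mul _ _ _ fun v hv => ?_
          refine (card_biUnion_le_card_mul _ _ ((Fintype.card V + 1) * B) fun G' hG' => ?_).trans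
            (Nat.mul_le_mul_right _ (ih _ (by rw [card_erase_of_mem hv, hc, Nat.add_sub_cancel])))
          obtain ⟨-, hGK, hGU⟩ := mem_filter.1 hG'
          refine (card_biUnion_le_card_mul _ _ B fun d hd => ?_).trans
            (Nat.mul_le_mul_right _ ((card_filter_le _ _).trans (card_range _).le))
          exact card_image_le.trans (hB G' _ d hGK hGU (mem_filter.1 hd).2)
      _ ≤ (Fintype.card V + 1) * (((Fintype.card V + 1) ^ 2 * B) ^ c *
            ((Fintype.card V + 1) * B)) :=
          Nat.mul_le_mul_right _ ((card_le_univ U).trans (Nat.le_succ _))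
      _ = _ := by ring

end

/-! ### Asymptotic estimates and conclusion -/

theorem eventually_mul_logb_pow_le (A : ℝ) (k : ℕ) {s : ℝ} (hs : 0 < s) :
    ∀ᶠ n : ℕ in Filter.atTop, A * Real.logb 2 (n + 1) ^ k ≤ (n : ℝ) ^ s := by
  have h := ((isLittleO_log_rpow_rpow_atTop (k : ℝ) hs).comp_tendsto
    (tendsto_natCast_atTop_atTop (R := ℝ))).bound
    (c := ((|A| + 1) * 4 ^ k)⁻¹) (by positivity)
  filter_upwards [h, Filter.eventually_ge_atTop 2] with n hn hn2
  have hn2' : (2 : ℝ) ≤ n := by exact_mod_cast hn2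
  have hlog : 0 ≤ Real.log n := Real.log_nonneg (by linarith)
  simp only [Function.comp_apply, Real.rpow_natCast, norm_pow, Real.norm_of_nonneg hlog] at hn
  rw [Real.norm_of_nonneg (by positivity), inv_mul_eq_div, le_div_iff₀ (by positivity)] at hn
  have h1 : Real.log (n + 1) ≤ 2 * Real.log n := by
    rw [show (2 : ℝ) * Real.log n = Real.log ((n : ℝ) ^ 2) by rw [Real.log_pow]; norm_num]
    exact Real.log_le_log (by linarith) (by nlinarith)
  have h2 : Real.logb 2 (n + 1) ≤ 4 * Real.log n := by
    rw [Real.logb, div_le_iff₀ (Real.log_pos one_lt_two)]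
    nlinarith [Real.log_two_gt_d9]
  have h3 : 0 ≤ Real.logb 2 (n + 1) := Real.logb_nonneg one_lt_two (by linarith)
  calc A * Real.logb 2 (n + 1) ^ k ≤ (|A| + 1) * (4 * Real.log n) ^ k := by
        gcongr
        linarith [le_abs_self A]
    _ = Real.log n ^ k * ((|A| + 1) * 4 ^ k) := by ring
    _ ≤ _ := hn

theorem one_sub_one_div_pow_mul_lt_one {b Λ : ℝ} {n q : ℕ} (hb : 1 ≤ b)
    (hΛ : (n + 1 : ℝ) = 2 ^ Λ) (hΛ0 : 0 ≤ Λ) (hq : b * Λ ≤ q) : (1 - 1 / b) ^ q * n < 1 := by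
  have hb0 : 0 < b := by linarith
  have h1 : (1 - 1 / b) ^ q ≤ Real.exp (-Λ) := by
    have h2 : 0 ≤ 1 - 1 / b := by
      rw [sub_nonneg, div_le_one hb0]
      exact hb
    refine (pow_le_pow_left₀ h2 (Real.one_sub_le_exp_neg (1 / b)) q).trans ?_
    rw [← Real.exp_nat_mul, Real.exp_le_exp, mul_neg, neg_le_neg_iff, mul_one_div,
      le_div_iff₀ hb0, mul_comm]
    exact hq
  have h3 : (n : ℝ) < Real.exp Λ := by
    have : (2 : ℝ) ^ Λ ≤ Real.exp Λ := by
      rw [Real.rpow_def_of_pos two_pos, Real.exp_le_exp]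
      nlinarith [Real.log_two_lt_d9]
    linarith
  calc (1 - 1 / b) ^ q * n ≤ Real.exp (-Λ) * n := by gcongr
    _ < Real.exp (-Λ) * Real.exp Λ := by gcongr
    _ = 1 := by rw [← Real.exp_add, neg_add_cancel, Real.exp_zero]

theorem card_fewReturnsOn_univ_le {n j K : ℕ} (hn : 1 ≤ n) {Λ x : ℝ}
    (hΛ : (n + 1 : ℝ) = 2 ^ Λ) (hΛ1 : 1 ≤ Λ) (hx0 : 0 < x) (hx : x ^ (j + 2) = n)
    (hxΛ : ((2 * K + 4) + (K + 1) * (2 * 4 ^ (j + 1) * ((j + 1) * (K + 1)) + 1)) * Λ ^ (j + 4)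
      ≤ x) :
    ((fewReturnsOn (V := Fin n) (2 * (j + 1)) K Finset.univ).card : ℝ) ≤
      (2 : ℝ) ^ (3 * (((j + 2 : ℕ) : ℝ) + 1) * (n * x)) := by
  set c : ℝ := 2 * 4 ^ (j + 1) * ((j + 1) * (K + 1)) with hc
  have hc1 : 1 ≤ c := by
    have h1 : (1 : ℝ) ≤ 4 ^ (j + 1) := one_le_pow₀ (by norm_num)
    have h3 : (1 : ℝ) ≤ (j + 1) * (K + 1) :=
      one_le_mul_of_one_le_of_one_le (by simp) (by simp)
    exact one_le_mul_of_one_le_of_one_le (by linarith) h3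
  have hΛ0 : 0 ≤ Λ := by linarith
  have hb : 1 ≤ c * Λ ^ (j + 2) := one_le_mul_of_one_le_of_one_le hc1 (one_le_pow₀ hΛ1)
  set q := ⌈c * Λ ^ (j + 2) * Λ⌉₊ with hqdef
  have hq : c * Λ ^ (j + 2) * Λ ≤ q := Nat.le_ceil _
  have hq' : (q : ℝ) ≤ c * Λ ^ (j + 3) + 1 := by
    refine (Nat.ceil_lt_add_one (by positivity)).le.trans (le_of_eq ?_)
    ring
  have hne : Nonempty (Fin n) := ⟨⟨0, hn⟩⟩
  have hpow1 : Λ ≤ Λ ^ (j + 4) := le_self_pow₀ hΛ1 (by omega)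
  have hpow2 : Λ ^ (j + 3) * Λ = Λ ^ (j + 4) := by ring
  have hxΛ1 : Λ * (2 * K + 4) ≤ x := by
    refine le_trans ?_ hxΛ
    have h1 : Λ * (2 * K + 4) ≤ (2 * K + 4) * Λ ^ (j + 4) := by
      rw [mul_comm]
      gcongr
    have h2 : 0 ≤ (K + 1) * (c + 1) * Λ ^ (j + 4) := by positivity
    linarith
  -- The costs of `v`, `d` and the fingerprint fit into `3x`; this turns the container exponent
  -- `3ℓx` into `3(ℓ + 1)x`.
  have hxΛ2 : 2 * Λ + Λ * ((K + 1) * q) ≤ 3 * x := by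
    have h1 : Λ * ((K + 1) * q) ≤ (K + 1) * (c + 1) * Λ ^ (j + 4) := by
      calc Λ * ((K + 1) * q) ≤ Λ * ((K + 1) * (c * Λ ^ (j + 3) + 1)) := by gcongr
        _ = (K + 1) * (c * Λ ^ (j + 4) + Λ) := by rw [← hpow2]; ring
        _ ≤ (K + 1) * (c * Λ ^ (j + 4) + Λ ^ (j + 4)) := by gcongr
        _ = _ := by ring
    have h2 : 2 * Λ ≤ (2 * K + 4) * Λ ^ (j + 4) := by
      have : (0 : ℝ) ≤ K := by positivity
      gcongr
      linarith
    linarith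
  have hB := fun (G : SimpleGraph (Fin n)) (U : Finset (Fin n)) (d : ℕ) hG hU hD =>
    Nat.le_floor (card_sparseSubsets_le (G := G) (j := j) (K := K) (d := d) (q := q) (U := U)
      hG hU hD (by rw [hx, Fintype.card_fin]) hx0 hΛ1 (by rw [Fintype.card_fin, hΛ]) hxΛ1
      (by rw [Fintype.card_fin]; exact one_sub_one_div_pow_mul_lt_one hb hΛ hΛ0 hq))
  have h := card_fewReturnsOn_le hB Finset.univ
  rw [Finset.card_univ, Fintype.card_fin] at h
  set e : ℝ := Λ * ((K + 1) * q) + 3 * ((j + 2) * x) with he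
  calc ((fewReturnsOn (V := Fin n) (2 * (j + 1)) K Finset.univ).card : ℝ)
      ≤ ((n + 1 : ℝ) ^ 2 * ⌊(2 : ℝ) ^ e⌋₊) ^ n := by exact_mod_cast h
    _ ≤ ((2 : ℝ) ^ (2 * Λ) * (2 : ℝ) ^ e) ^ n := by
        rw [hΛ, ← Real.rpow_mul_natCast two_pos.le, mul_comm Λ, Nat.cast_ofNat]
        gcongr
        exact Nat.floor_le (by positivity)
    _ = (2 : ℝ) ^ ((2 * Λ + e) * n) := by
        rw [← Real.rpow_add two_pos, Real.rpow_mul_natCast two_pos.le]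
    _ ≤ _ := by
        refine Real.rpow_le_rpow_of_exponent_le one_le_two ?_
        push_cast
        calc (2 * Λ + e) * n ≤ (3 * x + 3 * ((j + 2) * x)) * n := by
              refine mul_le_mul_of_nonneg_right ?_ (Nat.cast_nonneg n)
              linarith
          _ = _ := by ring

theorem theorem5 (ℓ : ℕ) (hℓ : 3 ≤ ℓ) (L : ℝ) (hL : 0 < L) :
    ∃ N : ℕ, ∀ n : ℕ, N ≤ n →
      ((sparseCycleFamily n (2 * ℓ) L).ncard : ℝ) ≤
        (2 : ℝ) ^ (3 * ((ℓ : ℝ) + 1) * (n : ℝ) ^ (1 + 1 / (ℓ : ℝ))) := by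
  obtain ⟨j, rfl⟩ := Nat.exists_eq_add_of_le' (show 2 ≤ ℓ by omega)
  obtain ⟨K, hK⟩ : ∃ K, K = 2 * (j + 2) * ⌊L⌋₊ := ⟨_, rfl⟩
  have hs : (0 : ℝ) < 1 / ((j + 2 : ℕ) : ℝ) := by positivity
  obtain ⟨N, hN⟩ := Filter.eventually_atTop.1 (eventually_mul_logb_pow_le
    ((2 * K + 4) + (K + 1) * (2 * 4 ^ (j + 1) * ((j + 1) * (K + 1)) + 1)) (j + 4) hs)
  refine ⟨max N 1, fun n hn => ?_⟩
  have hn1 : 1 ≤ n := (le_max_right _ _).trans hn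
  have hn1' : (1 : ℝ) ≤ n := by exact_mod_cast hn1
  have hsub : sparseCycleFamily n (2 * (j + 2)) L ⊆
      (fewReturnsOn (V := Fin n) (2 * (j + 1)) K Finset.univ : Set (SimpleGraph (Fin n))) := by
    intro G hG
    have h : FewReturns G (2 * (j + 1)) K := hK ▸ fewReturns_of_mem_sparseCycleFamily (by omega) hG
    exact Finset.mem_coe.2 (mem_fewReturnsOn.2 ⟨h, fun _ _ _ => Finset.mem_univ _⟩)
  have hcard := Set.ncard_le_ncard hsub (Finset.finite_toSet _)
  rw [Set.ncard_coe_finset] at hcard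
  have hΛ : (n + 1 : ℝ) = 2 ^ Real.logb 2 (n + 1) :=
    (Real.rpow_logb two_pos (by norm_num) (by linarith)).symm
  have hΛ1 : 1 ≤ Real.logb 2 (n + 1) := by
    rw [Real.le_logb_iff_rpow_le one_lt_two (by linarith), Real.rpow_one]
    linarith
  have hx : ((n : ℝ) ^ (1 / ((j + 2 : ℕ) : ℝ))) ^ (j + 2) = n := by
    rw [one_div, Real.rpow_inv_natCast_pow (by linarith) (by omega)]
  have hx0 : 0 < (n : ℝ) ^ (1 / ((j + 2 : ℕ) : ℝ)) := Real.rpow_pos_of_pos (by linarith) _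
  rw [Real.rpow_add (by linarith), Real.rpow_one]
  exact (Nat.cast_le.2 hcard).trans
    (card_fewReturnsOn_univ_le hn1 hΛ hΛ1 hx0 hx (hN n ((le_max_left _ _).trans hn)))
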